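/- All topological spaces are Hausdorff, and $\omega=\{0,1,2,\dots\}$. A semitopological semigroup is a semigroup with a topology for which multiplication is separately continuous. A semigroup $S$ is inverse if every $x\in S$ has a unique $x^{-1}\in S$ with $xx^{-1}x=x$ and $x^{-1}xx^{-1}=x^{-1}$. It is simple if it has no non-empty proper two-sided ideal. It is an $\omega$-semigroup if its set of idempotents, ordered by $e\preccurlyeq f\iff ef=fe=e$, is order isomorphic to $(\omega,\ge)$. The maximal subgroup of $S$ at an idempotent $e$ is the group of units of the monoid $eSe$. A topological inverse semigroup is an inverse semigroup with a topology for which multiplication is jointly continuous and inversion is continuous. For a semilattice $E$, groups $G_\alpha$ ($\alpha\in E$) and homomorphisms $\varphi_{\alpha,\beta}\colon G_\alpha\to G_\beta$ ($\beta\le\alpha$) such that $\varphi_{\alpha,\alpha}$ is the identity and $\varphi_{\alpha,\gamma}$ is $\varphi_{\alpha,\beta}$ followed by $\varphi_{\beta,\gamma}$ for $\gamma\le\beta\le\alpha$, the semilattice of groups $T=[E;G_\alpha,\varphi_{\alpha,\beta}]$ is the disjoint union of the $G_\alpha$ with $a*b=\varphi_{\alpha,\alpha\beta}(a)\,\varphi_{\beta,\alpha\beta}(b)$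 for $a\in G_\alpha$, $b\in G_\beta$, where $\alpha\beta$ is the meet of $\alpha$ and $\beta$. For a monoid $T$ and a homomorphism $\theta$ from $T$ into its group of units, the Bruck–Reilly extension $\mathbf{BR}(T,\theta)$ is the set $\omega\times T\times\omega$ with $$(i,s,j)(k,t,l)=\bigl(i+k-m,\ \theta^{k-m}(s)\,\theta^{j-m}(t),\ j+l-m\bigr),\qquad m=\min\{j,k\}.$$ If $T$ carries a topology, the sum direct topology $\tau^{\oplus}_{\mathbf{BR}}$ on $\mathbf{BR}(T,\theta)$ has as a base the sets $U_{i,j}=\{(i,s,j):s\in U\}$ with $U\subseteq T$ open and $i,j\in\omega$. **Theorem 2.9.** Let $S$ be a Hausdorff semitopological simple inverse $\omega$-semigroup such that every maximal subgroup of $S$ is compact. Then there are a finite semilattice $E$ with a greatest element, compact Hausdorff topological groups $G_\alpha$ ($\alpha\in E$) and homomorphisms $\varphi_{\alpha,\beta}$ forming a semilattice of groups $T=[E;G_\alpha,\varphi_{\alpha,\beta}]$, which is therefore a monoid and is given the topology of the topological sum of the $G_\alpha$, and a homomorphism $\theta$ from $T$ into its group of units, such that: 1. $T$ and $(\mathbf{BR}(T,\theta),\tau^{\oplus}_{\mathbf{BR}})$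 are Hausdorff topological inverse semigroups, and for some $i\in\omega$ the map $s\mapsto(i,s,i)$ is a homeomorphism of $T$ onto $\{(i,s,i):s\in T\}$ with the subspace topology (that is, the extension is a topological Bruck–Reilly extension of $T$ in the class of topological inverse semigroups); 2. $S$ is topologically isomorphic to $(\mathbf{BR}(T,\theta),\tau^{\oplus}_{\mathbf{BR}})$. Moreover, the space $S$ is locally compact. -/

import Mathlib

universe u v

namespace OmegaSemigroup

/-! ### Inverse semigroups, simplicity, omega-semigroups, maximal subgroups -/

section Semigroups

variable (M : Type u) [Semigroup M]

/-- Every element `x` has exactly one inverse `y`, that is, `x y x = x` and `y x y = y`. -/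
def IsInverseSemigroup : Prop :=
  ∀ x : M, ∃! y : M, x * y * x = x ∧ y * x * y = y

/-- A semigroup is simple when its only (non-empty) two-sided ideal is the whole semigroup. -/
def IsSimpleSemigroup : Prop :=
  ∀ I : Set M, I.Nonempty → (∀ a : M, ∀ x ∈ I, a * x ∈ I ∧ x * a ∈ I) → I = Set.univ

variable {M}

/-- The natural partial order on idempotents: `e ≼ f` iff `e f = f e = e`. -/
def NatLE (e f : M) : Prop := e * f = e ∧ f * e = e

/-- The maximal subgroup of `M` with identity `e` (for `e` idempotent): the group of units of the
local monoid `e M e`. -/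
def maximalSubgroup (e : M) : Set M :=
  {x | e * x = x ∧ x * e = x ∧ ∃ y, e * y = y ∧ y * e = y ∧ x * y = e ∧ y * x = e}

variable (M)

/-- The set of idempotents with its natural partial order is order isomorphic to `(ω, ≥)`. -/
def IsOmegaSemigroup : Prop :=
  ∃ f : ℕ ≃ {e : M // IsIdempotentElem e}, ∀ m n : ℕ, NatLE (f m : M) (f n : M) ↔ m ≥ n

variable {M}

/-- The inversion of an inverse semigroup: it sends `x` to the unique inverse of `x`. -/
noncomputable def IsInverseSemigroup.inversion (h : IsInverseSemigroup M) : M → M :=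
  fun x => (h x).choose

theorem IsInverseSemigroup.inversion_spec (h : IsInverseSemigroup M) (x : M) :
    x * h.inversion x * x = x ∧ h.inversion x * x * h.inversion x = h.inversion x :=
  (h x).choose_spec.1

/-- A (Hausdorff) topological inverse semigroup: an inverse semigroup with a Hausdorff topology
for which multiplication is jointly continuous and the inversion is continuous. -/
structure IsTopologicalInverseSemigroup (M : Type u) [Semigroup M] [TopologicalSpace M] :
    Prop where
  t2 : T2Space M
  inverse : IsInverseSemigroup M
  continuous_mul : Continuous fun p : M × M => p.1 * p.2
  continuous_inversion : Continuous inverse.inversion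

end Semigroups

/-! ### Strong semilattices of groups -/

/-- The data `[E; G_α, φ_{α,β}]` of a strong semilattice of groups over the semilattice `E`. -/
structure SemilatticeOfGroups (E : Type u) [SemilatticeInf E] where
  /-- The groups `G_α`. -/
  G : E → Type v
  /-- The group structure of `G_α`. -/
  [group : ∀ α, Group (G α)]
  /-- The homomorphisms `φ_{α,β} : G_α → G_β` for `β ≤ α`. -/
  map : ∀ {α β : E}, β ≤ α → (G α →* G β)
  map_id : ∀ (α : E) (x : G α), map (le_refl α) x = x
  map_map : ∀ {α β γ : E} (hβ : β ≤ α) (hγ : γ ≤ β) (x : G α),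
    map hγ (map hβ x) = map (hγ.trans hβ) x

attribute [instance] SemilatticeOfGroups.group

namespace SemilatticeOfGroups

variable {E : Type u} [SemilatticeInf E] (D : SemilatticeOfGroups.{u, v} E)

/-- The underlying set of `[E; G_α, φ_{α,β}]`: the disjoint union of the groups `G_α`. -/
def Carrier : Type (max u v) := Σ α : E, D.G α

instance : Mul D.Carrier where
  mul a b := ⟨a.1 ⊓ b.1, D.map inf_le_left a.2 * D.map inf_le_right b.2⟩

theorem mk_congr {α β γ δ κ : E} (h : δ = κ) (h₁ : δ ≤ α) (h₂ : δ ≤ β) (h₃ : δ ≤ γ)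
    (k₁ : κ ≤ α) (k₂ : κ ≤ β) (k₃ : κ ≤ γ) (x : D.G α) (y : D.G β) (z : D.G γ) :
    (⟨δ, D.map h₁ x * D.map h₂ y * D.map h₃ z⟩ : Σ α : E, D.G α) =
      ⟨κ, D.map k₁ x * (D.map k₂ y * D.map k₃ z)⟩ := by
  subst h
  rw [mul_assoc]

instance : Semigroup D.Carrier where
  mul_assoc a b c := by
    obtain ⟨α, x⟩ := a
    obtain ⟨β, y⟩ := b
    obtain ⟨γ, z⟩ := c
    change (⟨α ⊓ β ⊓ γ, D.map inf_le_left (D.map inf_le_left x * D.map inf_le_right y) *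
        D.map inf_le_right z⟩ : Σ α : E, D.G α) =
      ⟨α ⊓ (β ⊓ γ), D.map inf_le_left x *
        D.map inf_le_right (D.map inf_le_left y * D.map inf_le_right z)⟩
    simp only [map_mul, map_map]
    exact D.mk_congr (inf_assoc α β γ) _ _ _ _ _ _ x y z

theorem mk_map_congr {α δ : E} (h : δ = α) (h₁ : δ ≤ α) (x : D.G α) :
    (⟨δ, D.map h₁ x⟩ : Σ α : E, D.G α) = ⟨α, x⟩ := by
  subst h
  rw [map_id]

/-- If `E` has a greatest element, the identity of its group is an identity of the whole
semilattice of groups. -/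
instance [OrderTop E] : Monoid D.Carrier where
  one := ⟨⊤, 1⟩
  one_mul a := by
    obtain ⟨α, x⟩ := a
    change (⟨⊤ ⊓ α, D.map inf_le_left 1 * D.map inf_le_right x⟩ : Σ α : E, D.G α) = ⟨α, x⟩
    rw [map_one, one_mul]
    exact D.mk_map_congr (top_inf_eq α) _ x
  mul_one a := by
    obtain ⟨α, x⟩ := a
    change (⟨α ⊓ ⊤, D.map inf_le_left x * D.map inf_le_right 1⟩ : Σ α : E, D.G α) = ⟨α, x⟩
    rw [map_one, mul_one]
    exact D.mk_map_congr (inf_top_eq α) _ x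

/-- The topological sum of the spaces `G_α`. -/
instance [∀ α, TopologicalSpace (D.G α)] : TopologicalSpace D.Carrier :=
  inferInstanceAs (TopologicalSpace (Σ α : E, D.G α))

end SemilatticeOfGroups

/-! ### Bruck-Reilly extensions -/

/-- The underlying set `ω × M × ω` of the Bruck-Reilly extension of the monoid `M` by the
homomorphism `θ` from `M` into its group of units. -/
@[ext]
structure BruckReilly (M : Type u) [Monoid M] (θ : M →* Mˣ) where
  /-- The first index. -/
  fst : ℕ
  /-- The middle coordinate. -/
  mid : M
  /-- The second index. -/
  snd : ℕ

namespace BruckReilly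

variable {M : Type u} [Monoid M] (θ : M →* Mˣ)

/-- `θ` regarded as an endomorphism of the monoid `M`; its powers are its iterates. -/
def toEnd : Monoid.End M := (Units.coeHom M).comp θ

variable {θ}

/-- `(i,s,j)(k,t,l) = (i+k-min(j,k), θ^{k-min(j,k)}(s) θ^{j-min(j,k)}(t), j+l-min(j,k))`. -/
instance : Mul (BruckReilly M θ) where
  mul a b :=
    ⟨a.fst + b.fst - min a.snd b.fst,
      (toEnd θ ^ (b.fst - min a.snd b.fst)) a.mid * (toEnd θ ^ (a.snd - min a.snd b.fst)) b.mid,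
      a.snd + b.snd - min a.snd b.fst⟩

theorem mul_def (a b : BruckReilly M θ) :
    a * b = ⟨a.fst + b.fst - min a.snd b.fst,
      (toEnd θ ^ (b.fst - min a.snd b.fst)) a.mid * (toEnd θ ^ (a.snd - min a.snd b.fst)) b.mid,
      a.snd + b.snd - min a.snd b.fst⟩ := rfl

theorem pow_pow_apply (f : Monoid.End M) (m n : ℕ) (x : M) :
    (f ^ m) ((f ^ n) x) = (f ^ (m + n)) x := by
  rw [pow_add]; rfl

instance : Semigroup (BruckReilly M θ) where
  mul_assoc a b c := by
    obtain ⟨i, s, j⟩ := a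
    obtain ⟨k, t, l⟩ := b
    obtain ⟨m, r, n⟩ := c
    simp only [mul_def, map_mul, pow_pow_apply, mul_assoc]
    ext
    · dsimp only; omega
    · dsimp only
      congr 1
      · congr 2; omega
      · congr 1
        · congr 2; omega
        · congr 2; omega
    · dsimp only; omega

variable (θ)

/-- The sum direct topology on the Bruck-Reilly extension: it is generated by the sets
`U_{i,j} = {(i,s,j) : s ∈ U}` with `U` open in `M` and `i, j ∈ ω`. -/
@[reducible]
def sumDirectTopology [TopologicalSpace M] : TopologicalSpace (BruckReilly M θ) :=
  TopologicalSpace.generateFrom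
    {W | ∃ (U : Set M) (i j : ℕ), IsOpen U ∧ W = (fun s => (⟨i, s, j⟩ : BruckReilly M θ)) '' U}

/-- For a class `C` of semitopological semigroups, the Bruck-Reilly extension with the topology `τ`
is a topological Bruck-Reilly extension of the space `M` in the class `C`: both belong to `C`, and
for some `i` the bijection `s ↦ (i,s,i)` from `M` onto `M_{i,i}`, with the topology restricted
from `τ`, is a homeomorphism. -/
def IsTopologicalExtension
    (C : ∀ (N : Type u) [Semigroup N] [TopologicalSpace N], Prop) [TopologicalSpace M]
    (τ : TopologicalSpace (BruckReilly M θ)) : Prop :=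
  C M ∧ C (BruckReilly M θ) ∧
    ∃ i : ℕ, Topology.IsEmbedding fun s : M => (⟨i, s, i⟩ : BruckReilly M θ)

end BruckReilly

end OmegaSemigroup

/-!
An inverse `ω`-semigroup `S` is a monoid whose idempotents form a chain `1 = e 0 > e 1 > ⋯`. Each
`x` has two indices, `x x⁻¹ = e (L x)` and `x⁻¹ x = e (R x)`. Since `ω` has no non-trivial order
automorphism, conjugation by `x` shifts the chain below `e (R x)` onto the chain below `e (L x)`
(`conj_e_add`), so that `x ↦ (L x, R x)` is a homomorphism into the bicyclic monoid (`L_mul`,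
`R_mul`) whose fibres are the `H`-classes, and an element with `L x = R x` commutes with all
idempotents.

*Topology.* Each `H`-class is empty or a translate of a maximal subgroup, hence compact. The
complement of `e N * S ∪ S * e N` is open and a union of finitely many `H`-classes, so each `H`-class
is open (`isOpen_hClass`). Therefore `S` is locally compact. The maximal subgroups are topological
groups by Ellis' theorem, proved here for compact groups: for a continuous real function `f` the
functions `y ↦ f (x * y)` are, on every countable set of points `y`, a norm-separable family, which
gives an open set of `x` over which they vary little in norm, and this set can be translated.
Joint continuity in `S` follows because a product near a given one can be computed in a single
maximal subgroup (`continuous_mul`).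

*Algebra.* Simplicity gives `a` with `L a = 0` and `R a > 0`; when `d = R a` is least, all `x` satisfy
`L x ≡ R x` modulo `d` (`exists_period`). The first `d` maximal subgroups form the semilattice of
groups `T`, the homomorphism is `θ t = a t a⁻¹`, and `(i, t, j) ↦ a⁻ⁱ t aʲ` is an isomorphism of
`BR(T, θ)` onto `S`. As the `H`-classes are open, it is a homeomorphism for the sum direct topology,
and the topological properties of `T` and `BR(T, θ)` are inherited from `S`.
-/

/-! ### Ellis' theorem for compact groups -/

open Topology in
/-- The functions `F x`, restricted to the countable set of the points `z k`, form a norm-separable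
family. The reason is that on the closure of that set all of them factor through one compact
metrizable space `M`, and `C(M, ℝ)` is separable. -/
theorem exists_seq_approx_of_separately_continuous {X Y ι : Type*} [TopologicalSpace X]
    [TopologicalSpace Y] [CompactSpace X] [CompactSpace Y] [Nonempty X] [Countable ι] [Nonempty ι]
    (F : X → Y → ℝ) (hX : ∀ y, Continuous fun x => F x y) (hY : ∀ x, Continuous (F x))
    (z : ι → Y) :
    ∃ g : ℕ → ι → ℝ, ∀ x, ∀ ε > 0, ∃ n, ∀ k, |F x (z k) - g n k| ≤ ε := by
  let q : X → ι → ℝ := fun x k => F x (z k)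
  have hq : Continuous q := continuous_pi fun k => hX (z k)
  obtain ⟨d, hd⟩ : ∃ d : ℕ → X, Set.range q ⊆ closure (Set.range fun n => q (d n)) := by
    let u := TopologicalSpace.denseSeq (Set.range q)
    choose d hd using fun n => (u n).2
    refine ⟨d, fun w hw => ?_⟩
    have h1 : (⟨w, hw⟩ : Set.range q) ∈ closure (Set.range u) :=
      TopologicalSpace.denseRange_denseSeq (Set.range q) _
    have h2 := image_closure_subset_closure_image (continuous_subtype_val) ⟨_, h1, rfl⟩
    rw [← Set.range_comp] at h2
    convert h2 using 3
    ext1 n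
    exact hd n
  let Y' := closure (Set.range z)
  have hqY : ∀ x x', q x = q x' → ∀ y ∈ Y', F x y = F x' y := fun x x' h y hy => by
    refine Set.EqOn.closure (s := Set.range z) ?_ (hY x) (hY x') hy
    rintro _ ⟨k, rfl⟩
    exact congrFun h k
  -- Agreement of two points of the closure at all `d n` is agreement at every point of `X`.
  have hsep : ∀ y ∈ Y', ∀ y' ∈ Y', (∀ n, F (d n) y = F (d n) y') → ∀ x, F x y = F x y' := by
    intro y hy y' hy' h x
    have hcl : IsClosed (q '' {x | F x y = F x y'}) :=
      ((isClosed_eq (hX y) (hX y')).isCompact.image hq).isClosed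
    have : q x ∈ q '' {x | F x y = F x y'} := by
      refine hcl.closure_subset_iff.2 ?_ (hd ⟨x, rfl⟩)
      rintro _ ⟨n, rfl⟩
      exact ⟨d n, h n, rfl⟩
    obtain ⟨x', hx', hxx⟩ := this
    rw [← hqY x' x hxx y hy, ← hqY x' x hxx y' hy', hx']
  have : CompactSpace Y' := isCompact_iff_compactSpace.1 isClosed_closure.isCompact
  let p : Y' → ℕ → ℝ := fun y n => F (d n) y
  have hp : Continuous p := continuous_pi fun n => (hY (d n)).comp continuous_subtype_val
  have hM : CompactSpace (Set.range p) := isCompact_iff_compactSpace.1 (isCompact_range hp)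
  let p' : C(Y', Set.range p) := ⟨Set.rangeFactorization p, hp.rangeFactorization⟩
  have hp' : IsQuotientMap p' :=
    IsQuotientMap.of_surjective_continuous Set.rangeFactorization_surjective hp.rangeFactorization
  let r : X → C(Y', ℝ) := fun x => ⟨fun y => F x y, (hY x).comp continuous_subtype_val⟩
  have hr : ∀ x, Function.FactorsThrough (r x) p' := fun x y y' h =>
    hsep y y.2 y' y'.2 (fun n => congrFun (show p y = p y' from congrArg Subtype.val h) n) x
  let φ : X → C(Set.range p, ℝ) := fun x => hp'.lift (r x) (hr x)
  have hφ : ∀ x y, φ x (p' y) = F x y := fun x y =>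
    DFunLike.congr_fun (hp'.lift_comp (r x) (hr x)) y
  let z' : ι → Y' := fun k => ⟨z k, subset_closure ⟨k, rfl⟩⟩
  refine ⟨fun n k => TopologicalSpace.denseSeq C(Set.range p, ℝ) n (p' (z' k)), fun x ε hε => ?_⟩
  obtain ⟨_, hn, n, rfl⟩ := Metric.dense_iff.1
    (TopologicalSpace.denseRange_denseSeq C(Set.range p, ℝ)) (φ x) ε hε
  refine ⟨n, fun k => ?_⟩
  have := (ContinuousMap.dist_apply_le_dist (p' (z' k))).trans (Metric.mem_ball.1 hn).le
  rwa [dist_comm, Real.dist_eq, hφ] at this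

/-- A separately continuous function on a product of compact spaces has, for every `ε`, a non-empty
open set of first coordinates over which it varies by at most `ε`, uniformly in the second
coordinate. Otherwise there is a dyadic tree of open sets whose siblings are `ε`-separated by
points of `Y`; a branch of it can be made to avoid each ball of radius `ε / 2` about the members of
a given sequence, which contradicts `exists_seq_approx_of_separately_continuous`. -/
theorem exists_isOpen_forall_abs_sub_le {X Y : Type*} [TopologicalSpace X]
    [TopologicalSpace Y] [CompactSpace X] [T2Space X] [CompactSpace Y] [Nonempty X]
    (F : X → Y → ℝ) (hX : ∀ y, Continuous fun x => F x y) (hY : ∀ x, Continuous (F x))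
    {ε : ℝ} (hε : 0 < ε) :
    ∃ U : Set X, IsOpen U ∧ U.Nonempty ∧ ∀ u ∈ U, ∀ v ∈ U, ∀ y, |F u y - F v y| ≤ ε := by
  by_contra! hcon
  have shrink : ∀ (U : Set X) (x : X), IsOpen U → x ∈ U →
      ∃ V : Set X, (IsOpen V ∧ V.Nonempty) ∧ closure V ⊆ U := fun U x hU hx => by
    obtain ⟨t, ht, htc, htU⟩ := exists_mem_nhds_isClosed_subset (hU.mem_nhds hx)
    exact ⟨interior t, ⟨isOpen_interior, x, mem_interior_iff_mem_nhds.2 ht⟩,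
      (htc.closure_subset_iff.2 interior_subset).trans htU⟩
  have split : ∀ U : {U : Set X // IsOpen U ∧ U.Nonempty},
      ∃ (V : Bool → {U : Set X // IsOpen U ∧ U.Nonempty}) (y : Y),
        (∀ b, closure (V b).1 ⊆ U.1) ∧
        ∀ u ∈ (V false).1, ∀ v ∈ (V true).1, ε < |F u y - F v y| := by
    rintro ⟨U, hU, hU'⟩
    obtain ⟨u, hu, v, hv, y, hy⟩ := hcon U hU hU'
    set η := (|F u y - F v y| - ε) / 2 with hη
    have hη0 : 0 < η := by linarith
    have hopen : ∀ w, IsOpen (U ∩ {x | |F x y - F w y| < η}) := fun w =>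
      hU.inter (isOpen_lt ((hX y).sub continuous_const).abs continuous_const)
    obtain ⟨V₀, h₀, h₀'⟩ := shrink _ u (hopen u) ⟨hu, by simpa using hη0⟩
    obtain ⟨V₁, h₁, h₁'⟩ := shrink _ v (hopen v) ⟨hv, by simpa using hη0⟩
    refine ⟨fun b => bif b then ⟨V₁, h₁⟩ else ⟨V₀, h₀⟩, y, ?_, ?_⟩
    · rintro (_ | _)
      · exact h₀'.trans Set.inter_subset_left
      · exact h₁'.trans Set.inter_subset_left
    · intro a ha b hb
      have ha' : |F a y - F u y| < η := (h₀' (subset_closure ha)).2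
      have hb' : |F b y - F v y| < η := (h₁' (subset_closure hb)).2
      have h1 := abs_sub_abs_le_abs_sub (F u y - F v y) (F a y - F b y)
      have h2 : |F u y - F v y - (F a y - F b y)| ≤ |F a y - F u y| + |F b y - F v y| := by
        rw [show F u y - F v y - (F a y - F b y) = -(F a y - F u y) + (F b y - F v y) by ring]
        exact (abs_add_le _ _).trans (by rw [abs_neg])
      linarith
  choose V y hVU hV using split
  let W : List Bool → {U : Set X // IsOpen U ∧ U.Nonempty} := fun s =>
    s.rec ⟨Set.univ, isOpen_univ, Set.univ_nonempty⟩ fun b _ U => V U b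
  obtain ⟨g, hg⟩ := exists_seq_approx_of_separately_continuous F hX hY fun s => y (W s)
  have avoid : ∀ n s, ∃ b, ∀ x ∈ (W (b :: s)).1, ¬ ∀ k, |F x (y (W k)) - g n k| ≤ ε / 2 := by
    intro n s
    by_contra! h
    obtain ⟨u, hu, hu'⟩ := h false
    obtain ⟨v, hv, hv'⟩ := h true
    have h1 := hV (W s) u hu v hv
    have h2 := abs_sub_le (F u (y (W s))) (g n s) (F v (y (W s)))
    rw [abs_sub_comm (g n s)] at h2
    linarith [hu' s, hv' s]
  choose b hb using avoid
  let t : ℕ → List Bool := fun n => n.rec [] fun n s => b n s :: s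
  have hsub : ∀ n, closure (W (t (n + 1))).1 ⊆ (W (t n)).1 := fun n => hVU _ _
  obtain ⟨x, hx⟩ := IsCompact.nonempty_iInter_of_sequence_nonempty_isCompact_isClosed
    (fun n => closure (W (t n)).1) (fun n => (hsub n).trans subset_closure)
    (fun n => (W (t n)).2.2.closure) isClosed_closure.isCompact fun n => isClosed_closure
  rw [Set.mem_iInter] at hx
  obtain ⟨n, hn⟩ := hg x (ε / 2) (by positivity)
  exact hb n (t n) x (hsub (n + 1) (hx (n + 2))) hn

/-- Ellis' theorem for compact groups: separate continuity of the multiplication gives joint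
continuity. Left translations permute the second coordinates of `(x, y) ↦ f (x * y)`, so the open
set of small uniform oscillation found at one place can be moved to any other. -/
theorem continuousMul_of_compact_semitopological_group {G : Type*} [Group G] [TopologicalSpace G]
    [CompactSpace G] [T2Space G] [SeparatelyContinuousMul G] : ContinuousMul G := by
  refine ⟨continuous_iff_continuousAt.2 fun ⟨g, h⟩ => fun N hN => ?_⟩
  change N ∈ nhds (g * h) at hN
  obtain ⟨O, hON, hO, hghO⟩ := mem_nhds_iff.1 hN
  obtain ⟨f, hf, hf0, hf1⟩ := CompletelyRegularSpace.completely_regular (g * h) Oᶜ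
    hO.isClosed_compl (by simpa using hghO)
  let F : G → G → ℝ := fun x y => f (x * y)
  have hf' : Continuous fun x => (f x : ℝ) := continuous_subtype_val.comp hf
  obtain ⟨U, hU, ⟨a, ha⟩, hUF⟩ := exists_isOpen_forall_abs_sub_le F
    (fun y => hf'.comp (continuous_mul_const y)) (fun x => hf'.comp (continuous_const_mul x))
    (ε := 1 / 3) (by norm_num)
  have h1 : {x | x * (g⁻¹ * a) ∈ U} ∈ nhds g :=
    (hU.preimage (continuous_mul_const _)).mem_nhds (by simpa using ha)
  have h2 : {y | (f (g * y) : ℝ) < 1 / 3} ∈ nhds h :=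
    (isOpen_lt (hf'.comp (continuous_const_mul g)) continuous_const).mem_nhds (by simp [hf0])
  refine Filter.mem_map.2 (Filter.mem_of_superset (prod_mem_nhds h1 h2) ?_)
  rintro ⟨x, y⟩ ⟨hx, hy⟩
  refine hON (by_contra fun hxy => ?_)
  have h3 := hUF _ hx a ha (a⁻¹ * g * y)
  have h4 : (f (x * y) : ℝ) = 1 := by simpa using congrArg Subtype.val (hf1 hxy)
  simp only [F] at h3
  rw [show x * (g⁻¹ * a) * (a⁻¹ * g * y) = x * y by group,
    show a * (a⁻¹ * g * y) = g * y by group, h4] at h3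
  have h5 := le_abs_self (1 - (f (g * y) : ℝ))
  simp only [Set.mem_ofPred_eq] at hy
  linarith

/-- A compact Hausdorff group with separately continuous multiplication is a topological group. -/
theorem isTopologicalGroup_of_compact_semitopological_group {G : Type*} [Group G]
    [TopologicalSpace G] [CompactSpace G] [T2Space G] [SeparatelyContinuousMul G] :
    IsTopologicalGroup G := by
  have := continuousMul_of_compact_semitopological_group (G := G)
  refine { continuous_inv := ?_ }
  -- The graph of the inversion is closed, and the second projection from it is a closed map.
  refine continuous_iff_isClosed.2 fun C hC => ?_
  have : (·⁻¹) ⁻¹' C = Prod.fst '' ({p : G × G | p.1 * p.2 = 1} ∩ Prod.snd ⁻¹' C) := by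
    ext x
    constructor
    · exact fun hx => ⟨(x, x⁻¹), ⟨mul_inv_cancel x, hx⟩, rfl⟩
    · rintro ⟨⟨u, v⟩, ⟨huv, hv⟩, rfl⟩
      change u⁻¹ ∈ C
      rwa [inv_eq_of_mul_eq_one_right huv]
  rw [this]
  exact isClosedMap_fst_of_compactSpace _
    ((isClosed_eq continuous_mul continuous_const).inter (hC.preimage continuous_snd))

/-! ### Indices of the elements of an inverse `ω`-semigroup -/

namespace OmegaSemigroup

/-- An inverse `ω`-semigroup `S`, presented as a monoid with an enumeration `e 0 = 1 > e 1 > ⋯` of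
its idempotents. Every inverse `ω`-semigroup is a monoid, since its greatest idempotent is an
identity. -/
structure InverseOmegaMonoid (S : Type u) [Monoid S] where
  inverse : IsInverseSemigroup S
  /-- The enumeration of the idempotents in decreasing order. -/
  e : ℕ → S
  e_mul_e : ∀ m n, e m * e n = e (max m n)
  e_injective : Function.Injective e
  e_zero : e 0 = 1
  exists_e : ∀ x, IsIdempotentElem x → ∃ n, e n = x

namespace InverseOmegaMonoid

variable {S : Type u} [Monoid S] (C : InverseOmegaMonoid S)

/-- The inverse of `x` in the sense of inverse semigroups. -/
noncomputable def inv (x : S) : S := C.inverse.inversion x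

theorem mul_inv_mul (x : S) : x * C.inv x * x = x := (C.inverse.inversion_spec x).1

theorem inv_mul_inv (x : S) : C.inv x * x * C.inv x = C.inv x := (C.inverse.inversion_spec x).2

theorem eq_inv {x y : S} (h₁ : x * y * x = x) (h₂ : y * x * y = y) : y = C.inv x :=
  (C.inverse x).unique ⟨h₁, h₂⟩ (C.inverse.inversion_spec x)

theorem inv_inv (x : S) : C.inv (C.inv x) = x :=
  (C.eq_inv (C.inv_mul_inv x) (C.mul_inv_mul x)).symm

theorem e_mul_e_of_le {m n : ℕ} (h : m ≤ n) : C.e m * C.e n = C.e n := by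
  rw [C.e_mul_e, max_eq_right h]

theorem e_mul_e_of_ge {m n : ℕ} (h : m ≤ n) : C.e n * C.e m = C.e n := by
  rw [C.e_mul_e, max_eq_left h]

theorem isIdempotentElem_e (n : ℕ) : IsIdempotentElem (C.e n) := C.e_mul_e_of_le le_rfl

theorem exists_e_eq_mul_inv (x : S) : ∃ n, C.e n = x * C.inv x :=
  C.exists_e _ (by rw [IsIdempotentElem, ← mul_assoc, C.mul_inv_mul])

/-- The left index of `x`: the number of its left idempotent `x x⁻¹`. -/
noncomputable def L (x : S) : ℕ := (C.exists_e_eq_mul_inv x).choose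

/-- The right index of `x`: the number of its right idempotent `x⁻¹ x`. -/
noncomputable def R (x : S) : ℕ := C.L (C.inv x)

theorem mul_inv (x : S) : x * C.inv x = C.e (C.L x) := (C.exists_e_eq_mul_inv x).choose_spec.symm

theorem inv_mul (x : S) : C.inv x * x = C.e (C.R x) := by
  rw [R, ← C.mul_inv, C.inv_inv]

theorem L_inv (x : S) : C.L (C.inv x) = C.R x := rfl

theorem R_inv (x : S) : C.R (C.inv x) = C.L x := by rw [R, C.inv_inv]

theorem e_L_mul (x : S) : C.e (C.L x) * x = x := by rw [← C.mul_inv, C.mul_inv_mul]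

theorem mul_e_R (x : S) : x * C.e (C.R x) = x := by rw [← C.inv_mul, ← mul_assoc, C.mul_inv_mul]

theorem mul_e_of_le {x : S} {n : ℕ} (h : n ≤ C.R x) : x * C.e n = x := by
  rw [← C.mul_e_R x, mul_assoc, C.e_mul_e_of_ge h]

theorem e_mul_of_le {x : S} {n : ℕ} (h : n ≤ C.L x) : C.e n * x = x := by
  rw [← C.e_L_mul x, ← mul_assoc, C.e_mul_e_of_le h]

theorem le_L_of_e_mul {x : S} {n : ℕ} (h : C.e n * x = x) : n ≤ C.L x := by
  have : C.e (max n (C.L x)) = C.e (C.L x) := by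
    rw [← C.e_mul_e, ← C.mul_inv, ← mul_assoc, h]
  exact max_eq_right_iff.1 (C.e_injective this)

theorem le_R_of_mul_e {x : S} {n : ℕ} (h : x * C.e n = x) : n ≤ C.R x := by
  have : C.e (max (C.R x) n) = C.e (C.R x) := by
    rw [← C.e_mul_e, ← C.inv_mul, mul_assoc, h]
  exact max_eq_left_iff.1 (C.e_injective this)

theorem e_mul_iff {x : S} {n : ℕ} : C.e n * x = x ↔ n ≤ C.L x :=
  ⟨C.le_L_of_e_mul, C.e_mul_of_le⟩

theorem mul_e_iff {x : S} {n : ℕ} : x * C.e n = x ↔ n ≤ C.R x :=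
  ⟨C.le_R_of_mul_e, C.mul_e_of_le⟩

theorem L_eq_and_R_eq {x y : S} {m n : ℕ} (h₁ : x * y = C.e m) (h₂ : y * x = C.e n)
    (hx : C.e m * x = x) (hy : C.e n * y = y) : y = C.inv x ∧ C.L x = m ∧ C.R x = n := by
  have hinv : y = C.inv x := C.eq_inv (by rw [h₁, hx]) (by rw [h₂, hy])
  refine ⟨hinv, C.e_injective ?_, C.e_injective ?_⟩
  · rw [← C.mul_inv, ← hinv, h₁]
  · rw [← C.inv_mul, ← hinv, h₂]

theorem L_e (n : ℕ) : C.L (C.e n) = n :=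
  (C.L_eq_and_R_eq (C.isIdempotentElem_e n) (C.isIdempotentElem_e n) (C.isIdempotentElem_e n)
    (C.isIdempotentElem_e n)).2.1

theorem R_e (n : ℕ) : C.R (C.e n) = n :=
  (C.L_eq_and_R_eq (C.isIdempotentElem_e n) (C.isIdempotentElem_e n) (C.isIdempotentElem_e n)
    (C.isIdempotentElem_e n)).2.2

theorem exists_conj (x : S) (n : ℕ) :
    ∃ k, C.e (C.L x + k) = x * C.e (C.R x + n) * C.inv x := by
  have hid : IsIdempotentElem (x * C.e (C.R x + n) * C.inv x) := by
    have : x * C.e (C.R x + n) * C.inv x * (x * C.e (C.R x + n) * C.inv x) =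
        x * (C.e (C.R x + n) * (C.inv x * x) * C.e (C.R x + n)) * C.inv x := by
      simp only [mul_assoc]
    rw [IsIdempotentElem, this, C.inv_mul, C.e_mul_e_of_ge (Nat.le_add_right _ _),
      C.isIdempotentElem_e]
  obtain ⟨m, hm⟩ := C.exists_e _ hid
  have : C.L x ≤ m := by
    rw [← C.L_e m, ← C.e_mul_iff, hm, ← mul_assoc, ← mul_assoc, C.e_L_mul]
  exact ⟨m - C.L x, by rw [Nat.add_sub_cancel' this, hm]⟩

/-- Conjugation by `x` shifts the idempotents below `x⁻¹ x` onto those below `x x⁻¹`, because an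
order isomorphism between two copies of `ω` is unique. -/
theorem conj_e_add (x : S) (n : ℕ) :
    x * C.e (C.R x + n) * C.inv x = C.e (C.L x + n) := by
  have key : ∀ y : S, ∃ σ : ℕ → ℕ, StrictMono σ ∧
      ∀ n, C.e (C.L y + σ n) = y * C.e (C.R y + n) * C.inv y := by
    intro y
    choose σ hσ using C.exists_conj y
    refine ⟨σ, Monotone.strictMono_of_injective (fun m n hmn => ?_) (fun m n hmn => ?_), hσ⟩
    · have h1 : C.e (C.L y + σ m) * C.e (C.L y + σ n) = C.e (C.L y + σ n) := by
        have : y * C.e (C.R y + m) * C.inv y * (y * C.e (C.R y + n) * C.inv y) =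
            y * (C.e (C.R y + m) * (C.inv y * y) * C.e (C.R y + n)) * C.inv y := by
          simp only [mul_assoc]
        rw [hσ, hσ, this, C.inv_mul, C.e_mul_e_of_ge (Nat.le_add_right _ _),
          C.e_mul_e_of_le (by omega)]
      rw [C.e_mul_e] at h1
      have := C.e_injective h1
      omega
    · have h2 : ∀ k, C.e (C.R y + k) = C.inv y * C.e (C.L y + σ k) * y := fun k => by
        have : C.inv y * (y * C.e (C.R y + k) * C.inv y) * y =
            C.inv y * y * C.e (C.R y + k) * (C.inv y * y) := by simp only [mul_assoc]
        rw [hσ, this, C.inv_mul, C.e_mul_e_of_le (Nat.le_add_right _ _),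
          C.e_mul_e_of_ge (Nat.le_add_right _ _)]
      have := C.e_injective (((h2 m).trans (by rw [hmn])).trans (h2 n).symm)
      omega
  obtain ⟨σ, hσ, hσ'⟩ := key x
  obtain ⟨ρ, hρ, hρ'⟩ := key (C.inv x)
  have hρσ : ρ (σ n) = n := by
    have h1 := hρ' (σ n)
    have : C.inv x * (x * C.e (C.R x + n) * C.inv x) * x =
        C.inv x * x * C.e (C.R x + n) * (C.inv x * x) := by simp only [mul_assoc]
    rw [C.L_inv, C.R_inv, C.inv_inv, hσ', this, C.inv_mul,
      C.e_mul_e_of_le (Nat.le_add_right _ _), C.e_mul_e_of_ge (Nat.le_add_right _ _)] at h1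
    have := C.e_injective h1
    omega
  have h2 : σ n = n := le_antisymm ((hρ.le_apply (x := σ n)).trans hρσ.le) hσ.le_apply
  rw [← hσ', h2]

theorem conj_e (x : S) (n : ℕ) : x * C.e n * C.inv x = C.e (C.L x + (n - C.R x)) := by
  rcases le_total n (C.R x) with h | h
  · rw [C.mul_e_of_le h, C.mul_inv, Nat.sub_eq_zero_of_le h, add_zero]
  · rw [← C.conj_e_add, Nat.add_sub_cancel' h]

theorem mul_e (x : S) (n : ℕ) : x * C.e n = C.e (C.L x + (n - C.R x)) * x := by
  rw [← C.conj_e, mul_assoc _ (C.inv x), C.inv_mul, mul_assoc, C.e_mul_e, max_comm, ← C.e_mul_e,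
    ← mul_assoc, C.mul_e_R]

theorem mul_e_comm {x : S} (h : C.L x = C.R x) (n : ℕ) : x * C.e n = C.e n * x := by
  rw [C.mul_e]
  rcases le_total n (C.R x) with hn | hn
  · rw [Nat.sub_eq_zero_of_le hn, add_zero, C.e_L_mul, C.e_mul_of_le (hn.trans h.ge)]
  · rw [h, Nat.add_sub_cancel' hn]

theorem inv_mul_rev (x y : S) : C.inv (x * y) = C.inv y * C.inv x := by
  have h1 : x * y * (C.inv y * C.inv x) * (x * y) = x * y := by
    have : x * y * (C.inv y * C.inv x) * (x * y) =
        x * ((y * C.inv y) * (C.inv x * x)) * y := by simp only [mul_assoc]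
    rw [this, C.mul_inv, C.inv_mul, C.e_mul_e, max_comm, ← C.e_mul_e, ← mul_assoc, C.mul_e_R,
      mul_assoc, C.e_L_mul]
  have h2 : C.inv y * C.inv x * (x * y) * (C.inv y * C.inv x) = C.inv y * C.inv x := by
    have : C.inv y * C.inv x * (x * y) * (C.inv y * C.inv x) =
        C.inv y * ((C.inv x * x) * (y * C.inv y)) * C.inv x := by simp only [mul_assoc]
    rw [this, C.mul_inv, C.inv_mul, C.e_mul_e, max_comm, ← C.e_mul_e, ← mul_assoc,
      C.mul_e_of_le (C.R_inv y).ge, mul_assoc, C.e_mul_of_le (C.L_inv x).ge]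
  exact (C.eq_inv h1 h2).symm

/-- Together with `R_mul`: the pair `(L, R)` is a homomorphism of `S` into the bicyclic monoid. -/
theorem L_mul (x y : S) : C.L (x * y) = C.L x + (C.L y - C.R x) := by
  refine C.e_injective ?_
  have : x * y * (C.inv y * C.inv x) = x * (y * C.inv y) * C.inv x := by simp only [mul_assoc]
  rw [← C.mul_inv, C.inv_mul_rev, this, C.mul_inv, C.conj_e]

theorem R_mul (x y : S) : C.R (x * y) = C.R y + (C.R x - C.L y) := by
  rw [← C.L_inv, C.inv_mul_rev, C.L_mul, C.L_inv, C.L_inv, C.R_inv]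

/-- The set of the elements with left index `m` and right index `n`, a class of Green's relation
`H` when it is not empty. -/
def hClass (m n : ℕ) : Set S := {x | C.L x = m ∧ C.R x = n}

theorem maximalSubgroup_e (n : ℕ) : maximalSubgroup (C.e n) = C.hClass n n := by
  ext x
  constructor
  · rintro ⟨hx, -, y, hy, -, hxy, hyx⟩
    exact (C.L_eq_and_R_eq hxy hyx hx hy).2
  · rintro ⟨hL, hR⟩
    refine ⟨C.e_mul_of_le hL.ge, C.mul_e_of_le hR.ge, C.inv x, C.e_mul_of_le ?_,
      C.mul_e_of_le ?_, ?_, ?_⟩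
    · rw [C.L_inv, hR]
    · rw [C.R_inv, hL]
    · rw [C.mul_inv, hL]
    · rw [C.inv_mul, hR]

theorem mul_mem_hClass {x y : S} {n : ℕ} (hx : x ∈ C.hClass n n) (hy : y ∈ C.hClass n n) :
    x * y ∈ C.hClass n n := by
  obtain ⟨h1, h2⟩ := hx
  obtain ⟨h3, h4⟩ := hy
  exact ⟨by rw [C.L_mul]; omega, by rw [C.R_mul]; omega⟩

theorem e_mem_hClass (n : ℕ) : C.e n ∈ C.hClass n n := ⟨C.L_e n, C.R_e n⟩

theorem inv_mem_hClass {x : S} {m n : ℕ} (hx : x ∈ C.hClass m n) : C.inv x ∈ C.hClass n m :=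
  ⟨by rw [C.L_inv, hx.2], by rw [C.R_inv, hx.1]⟩

theorem inv_mul_mem_hClass {x y : S} {m n k : ℕ} (hx : x ∈ C.hClass m n) (hy : y ∈ C.hClass m k) :
    C.inv x * y ∈ C.hClass n k := by
  obtain ⟨h1, h2⟩ := hx
  obtain ⟨h3, h4⟩ := hy
  exact ⟨by rw [C.L_mul, C.L_inv, C.R_inv]; omega, by rw [C.R_mul, C.R_inv]; omega⟩

theorem mul_inv_mul_cancel {x y : S} (h : C.L x = C.L y) : x * (C.inv x * y) = y := by
  rw [← mul_assoc, C.mul_inv, h, C.e_L_mul]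

theorem mul_inv_cancel_right {x y : S} (h : C.R y = C.R x) : y * C.inv x * x = y := by
  rw [mul_assoc, C.inv_mul, ← h, C.mul_e_R]

/-- The diagonal `H`-classes are groups. -/
noncomputable instance hClassGroup (n : ℕ) : Group (C.hClass n n) where
  mul x y := ⟨x * y, C.mul_mem_hClass x.2 y.2⟩
  mul_assoc x y z := Subtype.ext (mul_assoc (x : S) y z)
  one := ⟨C.e n, C.e_mem_hClass n⟩
  one_mul x := Subtype.ext (C.e_mul_of_le x.2.1.ge)
  mul_one x := Subtype.ext (C.mul_e_of_le x.2.2.ge)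
  inv x := ⟨C.inv x, C.inv_mem_hClass x.2⟩
  inv_mul_cancel x := Subtype.ext ((C.inv_mul x).trans (by rw [x.2.2]; rfl))

end InverseOmegaMonoid

/-- The greatest idempotent of an inverse `ω`-semigroup is an identity. -/
theorem exists_inverseOmegaMonoid {S : Type u} [h : Semigroup S] (hinv : IsInverseSemigroup S)
    (homega : IsOmegaSemigroup S) :
    ∃ M : Monoid S, M.toSemigroup = h ∧ Nonempty (@InverseOmegaMonoid S M) := by
  obtain ⟨f, hf⟩ := homega
  have h0 : ∀ x : S, IsIdempotentElem x → (f 0 : S) * x = x ∧ x * f 0 = x := fun x hx => by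
    obtain ⟨n, hn⟩ := f.surjective ⟨x, hx⟩
    have := (hf n 0).2 (Nat.zero_le n)
    rw [hn] at this
    exact ⟨this.2, this.1⟩
  have hl : ∀ x : S, (f 0 : S) * x = x := fun x => by
    obtain ⟨y, ⟨hy, -⟩, -⟩ := hinv x
    rw [← hy, ← mul_assoc, (h0 (x * y) (by rw [IsIdempotentElem, ← mul_assoc, hy])).1]
  have hr : ∀ x : S, x * (f 0 : S) = x := fun x => by
    obtain ⟨y, ⟨hy, -⟩, -⟩ := hinv x
    have : IsIdempotentElem (y * x) := by rw [IsIdempotentElem, mul_assoc, ← mul_assoc x, hy]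
    rw [← hy, mul_assoc x, mul_assoc x, (h0 (y * x) this).2]
  let M : Monoid S := { h with one := f 0, one_mul := hl, mul_one := hr }
  refine ⟨M, rfl, ⟨⟨hinv, fun n => f n, fun m n => ?_, ?_, rfl, ?_⟩⟩⟩
  · rcases le_total m n with hmn | hmn
    · rw [max_eq_right hmn]
      exact ((hf n m).2 hmn).2
    · rw [max_eq_left hmn]
      exact ((hf m n).2 hmn).1
  · exact Subtype.val_injective.comp f.injective
  · intro x hx
    obtain ⟨n, hn⟩ := f.surjective ⟨x, hx⟩
    exact ⟨n, congrArg Subtype.val hn⟩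

end OmegaSemigroup

/-! ### Semitopological inverse `ω`-semigroups with compact maximal subgroups -/

namespace OmegaSemigroup

namespace InverseOmegaMonoid

variable {S : Type u} [Monoid S] (C : InverseOmegaMonoid S) [TopologicalSpace S]
  [SeparatelyContinuousMul S]

theorem isCompact_hClass (hc : ∀ n, IsCompact (C.hClass n n)) (m n : ℕ) :
    IsCompact (C.hClass m n) := by
  rcases (C.hClass m n).eq_empty_or_nonempty with h | ⟨x, hx⟩
  · rw [h]
    exact isCompact_empty
  · have : C.hClass m n ⊆ (fun y => x * y) '' C.hClass n n := fun y hy =>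
      ⟨C.inv x * y, C.inv_mul_mem_hClass hx hy, C.mul_inv_mul_cancel (hx.1.trans hy.1.symm)⟩
    have h2 : (fun y => x * y) '' C.hClass n n ⊆ C.hClass m n := by
      rintro _ ⟨y, ⟨h1, h2⟩, rfl⟩
      obtain ⟨h3, h4⟩ := hx
      exact ⟨by rw [C.L_mul]; omega, by rw [C.R_mul]; omega⟩
    rw [this.antisymm h2]
    exact (hc n).image (continuous_const_mul x)

variable [T2Space S]

/-- The set of the elements whose two indices are less than `N` is open, being the complement of
`e N * S ∪ S * e N`, and it is the union of finitely many compact `H`-classes. -/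
theorem isOpen_hClass (hc : ∀ n, IsCompact (C.hClass n n)) (m n : ℕ) :
    IsOpen (C.hClass m n) := by
  let N := max m n + 1
  let P := ((Finset.range N ×ˢ Finset.range N).erase (m, n))
  have : C.hClass m n =
      ({x | C.e N * x = x} ∪ {x | x * C.e N = x} ∪ ⋃ p ∈ P, C.hClass p.1 p.2)ᶜ := by
    ext x
    have hP : x ∈ ⋃ p ∈ P, C.hClass p.1 p.2 ↔
        ¬ (C.L x = m ∧ C.R x = n) ∧ C.L x < N ∧ C.R x < N := by
      simp only [Set.mem_iUnion, P, Finset.mem_erase, Finset.mem_product, Finset.mem_range, hClass,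
        ne_eq]
      constructor
      · rintro ⟨⟨i, j⟩, ⟨h1, h2, h3⟩, rfl, rfl⟩
        exact ⟨fun h => h1 (Prod.ext h.1 h.2), h2, h3⟩
      · rintro ⟨h1, h2, h3⟩
        exact ⟨(C.L x, C.R x), ⟨fun h => h1 (Prod.ext_iff.1 h), h2, h3⟩, rfl, rfl⟩
    simp only [Set.mem_compl_iff, Set.mem_union, hP]
    change (C.L x = m ∧ C.R x = n) ↔ ¬ ((C.e N * x = x ∨ x * C.e N = x) ∨ _)
    rw [C.e_mul_iff, C.mul_e_iff]
    omega
  rw [this]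
  refine IsClosed.isOpen_compl (self := ((isClosed_eq (continuous_const_mul _) continuous_id).union
    (isClosed_eq (continuous_mul_const _) continuous_id)).union ?_)
  exact P.finite_toSet.isClosed_biUnion fun p _ => (C.isCompact_hClass hc _ _).isClosed

theorem locallyCompactSpace (hc : ∀ n, IsCompact (C.hClass n n)) : LocallyCompactSpace S := by
  have : WeaklyLocallyCompactSpace S := ⟨fun x => ⟨C.hClass (C.L x) (C.R x),
    C.isCompact_hClass hc _ _, (C.isOpen_hClass hc _ _).mem_nhds ⟨rfl, rfl⟩⟩⟩
  infer_instance

theorem isTopologicalGroup_hClass (hc : ∀ n, IsCompact (C.hClass n n)) (n : ℕ) :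
    IsTopologicalGroup (C.hClass n n) := by
  have := isCompact_iff_compactSpace.1 (hc n)
  have : SeparatelyContinuousMul (C.hClass n n) :=
    ⟨fun {a} => ((continuous_const_mul (a : S)).comp continuous_subtype_val).subtype_mk _,
      fun {a} => ((continuous_mul_const (a : S)).comp continuous_subtype_val).subtype_mk _⟩
  exact isTopologicalGroup_of_compact_semitopological_group

/-- Near `(x, y)` the product is `x * (u * v) * y`, where `u` and `v` lie in one and the same
maximal subgroup and depend continuously on the factors. -/
theorem continuous_mul (hc : ∀ n, IsCompact (C.hClass n n)) :
    Continuous fun p : S × S => p.1 * p.2 := by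
  refine continuous_iff_continuousAt.2 fun ⟨x, y⟩ => ?_
  set N := max (C.R x) (C.L y) with hN
  let V := C.hClass (C.L x) (C.R x) ×ˢ C.hClass (C.L y) (C.R y)
  have hV : V ∈ nhds (x, y) := ((C.isOpen_hClass hc _ _).prod (C.isOpen_hClass hc _ _)).mem_nhds
    ⟨⟨rfl, rfl⟩, ⟨rfl, rfl⟩⟩
  have hu : ∀ p : V, C.inv x * p.1.1 * C.e N ∈ C.hClass N N := by
    rintro ⟨⟨z, w⟩, ⟨h1, h2⟩, -⟩
    dsimp only at h1 h2 ⊢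
    refine ⟨?_, ?_⟩ <;> simp only [C.L_mul, C.R_mul, C.L_inv, C.R_inv, C.L_e, C.R_e] <;> omega
  have hv : ∀ p : V, C.e N * (p.1.2 * C.inv y) ∈ C.hClass N N := by
    rintro ⟨⟨z, w⟩, -, ⟨h1, h2⟩⟩
    dsimp only at h1 h2 ⊢
    refine ⟨?_, ?_⟩ <;> simp only [C.L_mul, C.R_mul, C.L_inv, C.R_inv, C.L_e, C.R_e] <;> omega
  have := C.isTopologicalGroup_hClass hc N
  have hcont : Continuous fun p : V =>
      x * ((⟨_, hu p⟩ * ⟨_, hv p⟩ : C.hClass N N) : S) * y := by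
    refine ((continuous_subtype_val.comp (Continuous.mul ?_ ?_)).const_mul x).mul_const y
    · exact Continuous.subtype_mk
        (((continuous_fst.comp continuous_subtype_val).const_mul _).mul_const _) _
    · exact Continuous.subtype_mk
        (((continuous_snd.comp continuous_subtype_val).mul_const _).const_mul _) _
  refine ContinuousOn.continuousAt (continuousOn_iff_continuous_domRestrict.2 ?_) hV
  convert hcont using 1
  ext ⟨⟨z, w⟩, hz, hw⟩
  change z * w = x * (C.inv x * z * C.e N * (C.e N * (w * C.inv y))) * y
  have h1 : x * (C.inv x * z * C.e N * (C.e N * (w * C.inv y))) * y =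
      x * (C.inv x * z) * (C.e N * C.e N) * (w * C.inv y * y) := by simp only [mul_assoc]
  rw [h1, C.mul_inv_mul_cancel hz.1.symm, C.mul_inv_cancel_right hw.2, C.isIdempotentElem_e, hN,
    ← C.e_mul_e, ← mul_assoc, C.mul_e_of_le hz.2.ge, mul_assoc, C.e_mul_of_le hw.1.ge]

theorem continuous_inv (hc : ∀ n, IsCompact (C.hClass n n)) : Continuous C.inv := by
  refine continuous_iff_continuousAt.2 fun x => ?_
  have hV : C.hClass (C.L x) (C.R x) ∈ nhds x := (C.isOpen_hClass hc _ _).mem_nhds ⟨rfl, rfl⟩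
  have := C.isTopologicalGroup_hClass hc (C.R x)
  have hcont : Continuous fun p : C.hClass (C.L x) (C.R x) =>
      (((⟨_, C.inv_mul_mem_hClass ⟨rfl, rfl⟩ p.2⟩ : C.hClass (C.R x) (C.R x))⁻¹ :
        C.hClass (C.R x) (C.R x)) : S) * C.inv x :=
    (continuous_subtype_val.comp (Continuous.inv
      (Continuous.subtype_mk (continuous_subtype_val.const_mul _) _))).mul_const _
  refine ContinuousOn.continuousAt (continuousOn_iff_continuous_domRestrict.2 ?_) hV
  convert hcont using 1
  ext ⟨z, hz⟩
  change C.inv z = C.inv (C.inv x * z) * C.inv x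
  rw [C.inv_mul_rev, C.inv_inv, mul_assoc, C.mul_inv, ← hz.1, ← C.R_inv, C.mul_e_R]

theorem isTopologicalInverseSemigroup (hc : ∀ n, IsCompact (C.hClass n n)) :
    IsTopologicalInverseSemigroup S :=
  ⟨inferInstance, C.inverse, C.continuous_mul hc, C.continuous_inv hc⟩

end InverseOmegaMonoid

/-- A semigroup that embeds, algebraically and topologically, onto a subsemigroup closed under
inversion of a topological inverse semigroup is itself one. -/
theorem IsTopologicalInverseSemigroup.of_isEmbedding {M N : Type u} [Semigroup M]
    [TopologicalSpace M] [Semigroup N] [TopologicalSpace N] (h : IsTopologicalInverseSemigroup N)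
    (f : M → N) (hf : Topology.IsEmbedding f) (hmul : ∀ x y, f (x * y) = f x * f y)
    (hinv : ∀ x, ∃ y, f y = h.inverse.inversion (f x)) : IsTopologicalInverseSemigroup M := by
  have := h.t2
  have huniq : ∀ x y : M, x * y * x = x → y * x * y = y → f y = h.inverse.inversion (f x) :=
    fun x y h1 h2 => (h.inverse (f x)).unique ⟨by rw [← hmul, ← hmul, h1], by
      rw [← hmul, ← hmul, h2]⟩ (h.inverse.inversion_spec _)
  have hI : IsInverseSemigroup M := fun x => by
    obtain ⟨y, hy⟩ := hinv x
    obtain ⟨h1, h2⟩ := h.inverse.inversion_spec (f x)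
    refine ⟨y, ⟨hf.injective ?_, hf.injective ?_⟩, fun z hz => hf.injective ?_⟩
    · rw [hmul, hmul, hy, h1]
    · rw [hmul, hmul, hy, h2]
    · rw [huniq x z hz.1 hz.2, hy]
  refine ⟨hf.t2Space, hI, hf.continuous_iff.2 ?_, hf.continuous_iff.2 ?_⟩
  · have : f ∘ (fun p : M × M => p.1 * p.2) = fun p => f p.1 * f p.2 := funext fun p => hmul _ _
    rw [this]
    exact h.continuous_mul.comp (hf.continuous.prodMap hf.continuous)
  · have : f ∘ hI.inversion = h.inverse.inversion ∘ f := funext fun x =>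
      huniq x _ (hI.inversion_spec x).1 (hI.inversion_spec x).2
    rw [this]
    exact h.continuous_inversion.comp hf.continuous

end OmegaSemigroup

/-! ### The sum direct topology -/

namespace OmegaSemigroup

namespace BruckReilly

open Topology in
theorem isOpen_sumDirectTopology_iff {M : Type u} [Monoid M] [TopologicalSpace M] (θ : M →* Mˣ)
    {W : Set (BruckReilly M θ)} :
    IsOpen[sumDirectTopology θ] W ↔ ∀ i j, IsOpen {s | (⟨i, s, j⟩ : BruckReilly M θ) ∈ W} := by
  constructor
  · intro hW i j
    induction hW with
    | basic W h =>
      obtain ⟨U, k, l, hU, rfl⟩ := h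
      by_cases hkl : k = i ∧ l = j
      · obtain ⟨rfl, rfl⟩ := hkl
        convert hU using 1
        ext s
        constructor
        · rintro ⟨t, ht, h⟩
          obtain rfl : t = s := congrArg mid h
          exact ht
        · exact fun hs => ⟨s, hs, rfl⟩
      · convert isOpen_empty using 1
        refine Set.eq_empty_of_forall_notMem ?_
        rintro s ⟨t, -, h⟩
        exact hkl ⟨congrArg fst h, congrArg snd h⟩
    | univ => exact isOpen_univ
    | inter V W _ _ hV hW => exact hV.inter hW
    | sUnion K _ hK =>
      convert isOpen_biUnion hK using 1
      ext s
      simp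
  · intro h
    let _ := sumDirectTopology θ
    have : W = ⋃ i, ⋃ j, (fun s => (⟨i, s, j⟩ : BruckReilly M θ)) ''
        {s | (⟨i, s, j⟩ : BruckReilly M θ) ∈ W} := by
      ext ⟨i, s, j⟩
      simp only [Set.mem_iUnion]
      constructor
      · exact fun hs => ⟨i, j, s, hs, rfl⟩
      · rintro ⟨k, l, t, ht, h⟩
        exact h ▸ ht
    rw [this]
    exact isOpen_iUnion fun i => isOpen_iUnion fun j =>
      TopologicalSpace.isOpen_generateFrom_of_mem ⟨_, i, j, h i j, rfl⟩

theorem isEmbedding_mk {M : Type u} [Monoid M] [TopologicalSpace M] (θ : M →* Mˣ) (i : ℕ) :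
    @Topology.IsEmbedding _ _ _ (sumDirectTopology θ)
      fun s : M => (⟨i, s, i⟩ : BruckReilly M θ) := by
  let _ := sumDirectTopology θ
  have hinj : Function.Injective fun s : M => (⟨i, s, i⟩ : BruckReilly M θ) :=
    fun s t h => congrArg mid h
  refine (Topology.IsOpenEmbedding.of_continuous_injective_isOpenMap ?_ hinj ?_).isEmbedding
  · exact continuous_def.2 fun W hW => (isOpen_sumDirectTopology_iff θ).1 hW i i
  · exact fun U hU => TopologicalSpace.isOpen_generateFrom_of_mem ⟨U, i, i, hU, rfl⟩

end BruckReilly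

end OmegaSemigroup

/-! ### The semilattice of groups and its endomorphism -/

namespace OmegaSemigroup

/-- The chain of `d` levels, numbered downwards: level `0` is the greatest. -/
abbrev Level (d : ℕ) : Type u := ULift.{u} (Fin d)ᵒᵈ

namespace Level

variable {d : ℕ}

/-- The number of a level. -/
def val (α : Level.{u} d) : ℕ := (OrderDual.ofDual α.down : Fin d)

theorem val_lt (α : Level.{u} d) : α.val < d := Fin.is_lt _

theorem val_injective : Function.Injective (val : Level.{u} d → ℕ) := fun _ _ h =>
  ULift.down_injective (Fin.val_injective h)

theorem le_iff {α β : Level.{u} d} : α ≤ β ↔ β.val ≤ α.val := Iff.rfl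

theorem val_inf (α β : Level.{u} d) : (α ⊓ β).val = max α.val β.val := by
  rcases le_total α β with h | h
  · rw [inf_eq_left.2 h, max_eq_left (le_iff.1 h)]
  · rw [inf_eq_right.2 h, max_eq_right (le_iff.1 h)]

/-- The level with number `n < d`. -/
def mk (n : ℕ) (h : n < d) : Level.{u} d := ULift.up (OrderDual.toDual (⟨n, h⟩ : Fin d))

theorem val_top [NeZero d] : (⊤ : Level.{u} d).val = 0 :=
  Nat.le_zero.1 (le_iff.1 (le_top : mk 0 (NeZero.pos d) ≤ _))

end Level

namespace InverseOmegaMonoid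

variable {S : Type u} [Monoid S] (C : InverseOmegaMonoid S)

theorem L_R_pow {a : S} (ha : C.L a = 0) (n : ℕ) :
    C.L (a ^ n) = 0 ∧ C.R (a ^ n) = n * C.R a := by
  induction n with
  | zero => rw [pow_zero, ← C.e_zero, C.L_e, C.R_e, zero_mul]; exact ⟨rfl, rfl⟩
  | succ n ih => rw [pow_succ, C.L_mul, C.R_mul, ih.1, ih.2, ha, add_mul]; omega

/-- A simple inverse `ω`-semigroup contains an element that is `R`-related to `1` and is not a
unit. The smallest possible right index of such an element is a period of the pair of indices. -/
theorem exists_period (hs : IsSimpleSemigroup S) :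
    ∃ a, C.L a = 0 ∧ 0 < C.R a ∧ ∀ x, C.L x ≡ C.R x [MOD C.R a] := by
  have hex : ∃ n, 0 < n ∧ ∃ a, C.L a = 0 ∧ C.R a = n := by
    have huniv := hs {z | ∃ x y, z = x * C.e 1 * y} ⟨_, 1, 1, rfl⟩ (by
      rintro c _ ⟨x, y, rfl⟩
      exact ⟨⟨c * x, y, by simp only [mul_assoc]⟩, ⟨x, y * c, by simp only [mul_assoc]⟩⟩)
    obtain ⟨x, y, hxy⟩ : C.e 0 ∈ {z | ∃ x y, z = x * C.e 1 * y} := huniv ▸ Set.mem_univ _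
    have h1 := congrArg C.L hxy
    rw [C.L_e, C.L_mul, C.L_mul, C.L_e] at h1
    exact ⟨C.R x, by omega, x, by omega, rfl⟩
  classical
  obtain ⟨hpos, a, ha, had⟩ := Nat.find_spec hex
  have hmin : ∀ x, C.L x = 0 → C.R x < Nat.find hex → C.R x = 0 := fun x hx hlt => by
    by_contra h
    exact Nat.find_min hex hlt ⟨Nat.pos_of_ne_zero h, x, hx, rfl⟩
  rw [← had] at hmin hpos
  set d := C.R a
  have hdvd : ∀ n x, C.L x = 0 → C.R x = n → d ∣ n := by
    intro n
    induction n using Nat.strong_induction_on with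
    | _ n ih =>
      intro x hx hn
      rcases lt_or_ge n d with h | h
      · rw [← hn, hmin x hx (hn ▸ h)]
        exact dvd_zero d
      · have h1 := ih (n - d) (by omega) (x * C.inv a)
          (by rw [C.L_mul, C.L_inv]; omega) (by rw [C.R_mul, C.L_inv, C.R_inv]; omega)
        have := dvd_add h1 (dvd_refl d)
        rwa [Nat.sub_add_cancel h] at this
  have hpow : ∀ n, C.L (a ^ n) = 0 ∧ C.R (a ^ n) = n * d := C.L_R_pow ha
  refine ⟨a, ha, hpos, fun x => ?_⟩
  -- The element `a ^ m * x`, with `m` the left index of `x`, has left index `0`.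
  have hle : C.L x ≤ C.L x * d := Nat.le_mul_of_pos_right _ hpos
  have h1 := hdvd _ (a ^ C.L x * x) (by rw [C.L_mul, (hpow _).1, (hpow _).2]; omega) rfl
  rw [C.R_mul, (hpow _).2] at h1
  obtain ⟨c, hc⟩ := h1
  have h2 : C.L x + d * c = C.R x + C.L x * d := by omega
  simpa [Nat.ModEq] using congrArg (· % d) h2

theorem mul_e_mul_mul_e (x : S) {y : S} (h : C.L y = C.R y) (n : ℕ) :
    x * C.e n * (y * C.e n) = x * y * C.e n := by
  rw [mul_assoc x, ← mul_assoc (C.e n), ← C.mul_e_comm h, mul_assoc y, C.isIdempotentElem_e,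
    mul_assoc]

/-- The semilattice of the first `d` maximal subgroups; the homomorphism onto a lower level
is multiplication by the idempotent of that level. -/
noncomputable def clifford (d : ℕ) : SemilatticeOfGroups.{u, u} (Level.{u} d) where
  G α := C.hClass α.val α.val
  group α := C.hClassGroup α.val
  map {α β} h :=
    { toFun x := ⟨x * C.e β.val, by
        have h1 : C.L (x : S) = α.val := x.2.1
        have h2 : C.R (x : S) = α.val := x.2.2
        have := Level.le_iff.1 h
        exact ⟨by rw [C.L_mul, C.L_e]; omega, by rw [C.R_mul, C.L_e, C.R_e]; omega⟩⟩
      map_one' := Subtype.ext (C.e_mul_e_of_le (Level.le_iff.1 h))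
      map_mul' x y := Subtype.ext
        (C.mul_e_mul_mul_e (x : S) (y.2.1.trans y.2.2.symm) β.val).symm }
  map_id α x := Subtype.ext (C.mul_e_of_le x.2.2.ge)
  map_map {α β γ} hβ hγ x := Subtype.ext <| by
    change (x : S) * C.e β.val * C.e γ.val = x * C.e γ.val
    rw [mul_assoc, C.e_mul_e_of_le (Level.le_iff.1 hγ)]

section Clifford

variable {d : ℕ}

/-- The embedding of the semilattice of groups `C.clifford d` into `S`. -/
def ofClifford (t : (C.clifford d).Carrier) : S := t.2.1

theorem L_ofClifford (t : (C.clifford d).Carrier) :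
    C.L (C.ofClifford t) = C.R (C.ofClifford t) := t.2.2.1.trans t.2.2.2.symm

theorem R_ofClifford_lt (t : (C.clifford d).Carrier) : C.R (C.ofClifford t) < d :=
  lt_of_eq_of_lt t.2.2.2 (Level.val_lt _)

theorem ofClifford_injective : Function.Injective (C.ofClifford (d := d)) := by
  rintro ⟨α, x⟩ ⟨β, y⟩ (h : x.1 = y.1)
  obtain rfl : α = β := Level.val_injective (by rw [← x.2.1, ← y.2.1, h])
  exact congrArg (Sigma.mk α) (Subtype.ext h)

theorem exists_ofClifford_eq {x : S} (h : C.L x = C.R x) (hd : C.R x < d) :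
    ∃ t : (C.clifford d).Carrier, C.ofClifford t = x :=
  ⟨⟨Level.mk (C.R x) hd, ⟨x, h, rfl⟩⟩, rfl⟩

theorem ofClifford_mul (s t : (C.clifford d).Carrier) :
    C.ofClifford (s * t) = C.ofClifford s * C.ofClifford t := by
  obtain ⟨α, x, hx⟩ := s
  obtain ⟨β, y, hy⟩ := t
  change x * C.e (α ⊓ β).val * (y * C.e (α ⊓ β).val) = x * y
  rw [C.mul_e_mul_mul_e x (hy.1.trans hy.2.symm), Level.val_inf, C.mul_e_of_le]
  obtain ⟨-, h2⟩ := hx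
  obtain ⟨h3, h4⟩ := hy
  rw [C.R_mul]
  omega

variable [NeZero d]

theorem ofClifford_one : C.ofClifford (1 : (C.clifford d).Carrier) = 1 := by
  change C.e (⊤ : Level d).val = 1
  rw [Level.val_top, C.e_zero]

variable {a : S}

theorem conj_mem_hClass (ha : C.L a = 0) (t : (C.clifford (C.R a)).Carrier) :
    a * C.ofClifford t * C.inv a ∈ C.hClass 0 0 := by
  have := C.R_ofClifford_lt t
  have := C.L_ofClifford t
  refine ⟨?_, ?_⟩ <;> simp only [C.L_mul, C.R_mul, C.L_inv, C.R_inv] <;> omega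

/-- The homomorphism `t ↦ a t a⁻¹` of the semilattice of groups into the group of units of `S`. -/
noncomputable def conjHom (ha : C.L a = 0) [NeZero (C.R a)] :
    (C.clifford (C.R a)).Carrier →* C.hClass 0 0 where
  toFun t := ⟨a * C.ofClifford t * C.inv a, C.conj_mem_hClass ha t⟩
  map_one' := Subtype.ext <| by
    change a * C.ofClifford 1 * C.inv a = C.e 0
    rw [C.ofClifford_one, mul_one, C.mul_inv, ha]
  map_mul' s t := Subtype.ext <| by
    change a * C.ofClifford (s * t) * C.inv a =
      a * C.ofClifford s * C.inv a * (a * C.ofClifford t * C.inv a)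
    have : a * C.ofClifford s * C.inv a * (a * C.ofClifford t * C.inv a) =
        a * C.ofClifford s * ((C.inv a * a) * C.ofClifford t) * C.inv a := by
      simp only [mul_assoc]
    rw [this, C.inv_mul, ← C.mul_e_comm (C.L_ofClifford t), C.ofClifford_mul]
    simp only [mul_assoc, C.e_mul_of_le (C.L_inv a).ge]

/-- The group of units of `S` as the top group of the semilattice of groups. -/
noncomputable def topHom (d : ℕ) [NeZero d] : C.hClass 0 0 →* (C.clifford d).Carrier where
  toFun x := ⟨⊤, ⟨x, x.2.1.trans Level.val_top.symm, x.2.2.trans Level.val_top.symm⟩⟩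
  map_one' := C.ofClifford_injective <| by
    rw [C.ofClifford_one, ← C.e_zero]
    rfl
  map_mul' x y := C.ofClifford_injective ((C.ofClifford_mul _ _).symm ▸ rfl)

/-- The homomorphism `θ` of the Bruck-Reilly extension, `t ↦ a t a⁻¹`. -/
noncomputable def theta (ha : C.L a = 0) [NeZero (C.R a)] :
    (C.clifford (C.R a)).Carrier →* (C.clifford (C.R a)).Carrierˣ :=
  (C.topHom (C.R a)).toHomUnits.comp (C.conjHom ha)

theorem inv_pow (x : S) (n : ℕ) : C.inv (x ^ n) = C.inv x ^ n := by
  induction n with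
  | zero =>
    rw [pow_zero, pow_zero]
    exact (C.eq_inv (by simp) (by simp)).symm
  | succ n ih => rw [pow_succ', C.inv_mul_rev, ih, pow_succ]

theorem ofClifford_toEnd_pow [NeZero (C.R a)] (ha : C.L a = 0) (n : ℕ)
    (t : (C.clifford (C.R a)).Carrier) :
    C.ofClifford ((BruckReilly.toEnd (C.theta ha) ^ n) t) =
      a ^ n * C.ofClifford t * C.inv a ^ n := by
  induction n generalizing t with
  | zero => simp
  | succ n ih =>
    rw [← BruckReilly.pow_pow_apply, ih, pow_one]
    change a ^ n * (a * C.ofClifford t * C.inv a) * C.inv a ^ n = _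
    simp only [pow_succ a, pow_succ' (C.inv a), mul_assoc]

end Clifford

end InverseOmegaMonoid
end OmegaSemigroup

/-! ### The isomorphism with the Bruck-Reilly extension -/

namespace OmegaSemigroup
namespace InverseOmegaMonoid

variable {S : Type u} [Monoid S] (C : InverseOmegaMonoid S) {a : S}

theorem pow_mul_inv_pow (ha : C.L a = 0) (n : ℕ) : a ^ n * C.inv a ^ n = 1 := by
  rw [← C.inv_pow, C.mul_inv, (C.L_R_pow ha n).1, C.e_zero]

theorem inv_pow_mul_pow (ha : C.L a = 0) (n : ℕ) : C.inv a ^ n * a ^ n = C.e (n * C.R a) := by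
  rw [← C.inv_pow, C.inv_mul, (C.L_R_pow ha n).2]

theorem pow_mul_e (ha : C.L a = 0) (n : ℕ) : a ^ n * C.e (n * C.R a) = a ^ n := by
  rw [← (C.L_R_pow ha n).2, C.mul_e_R]

theorem e_mul_inv_pow (ha : C.L a = 0) (n : ℕ) : C.e (n * C.R a) * C.inv a ^ n = C.inv a ^ n := by
  rw [← C.inv_pow, C.e_mul_of_le]
  rw [C.L_inv, (C.L_R_pow ha n).2]

theorem inv_pow_mul_pow_mul (ha : C.L a = 0) {x : S} {i j : ℕ}
    (hi : i * C.R a ≤ C.L x) (hj : j * C.R a ≤ C.R x) :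
    C.inv a ^ i * (a ^ i * x * C.inv a ^ j) * a ^ j = x := by
  have : C.inv a ^ i * (a ^ i * x * C.inv a ^ j) * a ^ j =
      (C.inv a ^ i * a ^ i) * x * (C.inv a ^ j * a ^ j) := by simp only [mul_assoc]
  rw [this, C.inv_pow_mul_pow ha, C.inv_pow_mul_pow ha, C.e_mul_of_le hi, C.mul_e_of_le hj]

variable [NeZero (C.R a)] (ha : C.L a = 0)

/-- The map `(i, t, j) ↦ a⁻ⁱ t aʲ` of the Bruck-Reilly extension into `S`. -/
noncomputable def ofBruckReilly (p : BruckReilly (C.clifford (C.R a)).Carrier (C.theta ha)) : S :=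
  C.inv a ^ p.fst * C.ofClifford p.mid * a ^ p.snd

theorem ofBruckReilly_mul (p q : BruckReilly (C.clifford (C.R a)).Carrier (C.theta ha)) :
    C.ofBruckReilly ha (p * q) = C.ofBruckReilly ha p * C.ofBruckReilly ha q := by
  obtain ⟨i, s, j⟩ := p
  obtain ⟨k, t, l⟩ := q
  rw [BruckReilly.mul_def]
  simp only [ofBruckReilly, ofClifford_mul, ofClifford_toEnd_pow]
  set x := C.ofClifford s
  set y := C.ofClifford t
  set b := C.inv a
  have hxe : ∀ n, x * C.e n = C.e n * x := C.mul_e_comm (C.L_ofClifford s)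
  have hye : ∀ n, y * C.e n = C.e n * y := C.mul_e_comm (C.L_ofClifford t)
  have hab := C.pow_mul_inv_pow ha
  have hba := C.inv_pow_mul_pow ha
  -- Of the two conjugations in the product one is trivial; the other is undone by pulling an
  -- idempotent through `x`, respectively `y`.
  rcases le_total j k with h | h
  · obtain ⟨n, rfl⟩ := Nat.exists_eq_add_of_le h
    have e1 : i + (j + n) - min j (j + n) = i + n := by omega
    have e2 : j + n - min j (j + n) = n := by omega
    have e3 : j - min j (j + n) = 0 := by omega
    have e4 : j + l - min j (j + n) = l := by omega
    rw [e1, e2, e3, e4, pow_zero, pow_zero, one_mul, mul_one, pow_add b i, pow_add b j]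
    calc b ^ i * b ^ n * (a ^ n * x * b ^ n * y) * a ^ l
        = b ^ i * ((b ^ n * a ^ n) * x) * b ^ n * y * a ^ l := by simp only [mul_assoc]
      _ = b ^ i * x * (C.e (n * C.R a) * b ^ n) * y * a ^ l := by
          rw [hba, ← hxe]; simp only [mul_assoc]
      _ = b ^ i * x * ((a ^ j * b ^ j) * b ^ n) * y * a ^ l := by
          rw [hab, one_mul, C.e_mul_inv_pow ha]
      _ = b ^ i * x * a ^ j * (b ^ j * b ^ n * y * a ^ l) := by simp only [mul_assoc]
  · obtain ⟨n, rfl⟩ := Nat.exists_eq_add_of_le h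
    have e1 : i + k - min (k + n) k = i := by omega
    have e2 : k - min (k + n) k = 0 := by omega
    have e3 : k + n - min (k + n) k = n := by omega
    have e4 : k + n + l - min (k + n) k = n + l := by omega
    rw [e1, e2, e3, e4, pow_zero, pow_zero, one_mul, mul_one, pow_add a n, add_comm k n,
      pow_add a n]
    calc b ^ i * (x * (a ^ n * y * b ^ n)) * (a ^ n * a ^ l)
        = b ^ i * x * a ^ n * (y * (b ^ n * a ^ n)) * a ^ l := by simp only [mul_assoc]
      _ = b ^ i * x * (a ^ n * C.e (n * C.R a)) * y * a ^ l := by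
          rw [hba, hye]; simp only [mul_assoc]
      _ = b ^ i * x * (a ^ n * (a ^ k * b ^ k)) * y * a ^ l := by
          rw [hab, mul_one, C.pow_mul_e ha]
      _ = b ^ i * x * (a ^ n * a ^ k) * (b ^ k * y * a ^ l) := by simp only [mul_assoc]

theorem L_ofBruckReilly (p : BruckReilly (C.clifford (C.R a)).Carrier (C.theta ha)) :
    C.L (C.ofBruckReilly ha p) = p.fst * C.R a + C.R (C.ofClifford p.mid) := by
  simp only [ofBruckReilly, ← inv_pow, L_mul, R_mul, L_inv, R_inv, C.L_R_pow ha, C.L_ofClifford]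
  omega

theorem R_ofBruckReilly (p : BruckReilly (C.clifford (C.R a)).Carrier (C.theta ha)) :
    C.R (C.ofBruckReilly ha p) = p.snd * C.R a + C.R (C.ofClifford p.mid) := by
  simp only [ofBruckReilly, ← inv_pow, R_mul, R_inv, C.L_R_pow ha, C.L_ofClifford]
  omega

theorem pow_mul_ofBruckReilly_mul (p : BruckReilly (C.clifford (C.R a)).Carrier (C.theta ha)) :
    a ^ p.fst * C.ofBruckReilly ha p * C.inv a ^ p.snd = C.ofClifford p.mid := by
  have : a ^ p.fst * C.ofBruckReilly ha p * C.inv a ^ p.snd =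
      (a ^ p.fst * C.inv a ^ p.fst) * C.ofClifford p.mid * (a ^ p.snd * C.inv a ^ p.snd) := by
    simp only [ofBruckReilly, mul_assoc]
  rw [this, C.pow_mul_inv_pow ha, C.pow_mul_inv_pow ha, one_mul, mul_one]

theorem ofBruckReilly_injective : Function.Injective (C.ofBruckReilly ha) := by
  intro p q h
  have hd : 0 < C.R a := NeZero.pos _
  have hp := C.R_ofClifford_lt p.mid
  have hq := C.R_ofClifford_lt q.mid
  have hquot : ∀ {i j m n : ℕ}, m < C.R a → n < C.R a → i * C.R a + m = j * C.R a + n → i = j :=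
    fun {i j m n} hm hn h => by
      have := congrArg (· / C.R a) h
      simpa [Nat.add_comm _ m, Nat.add_comm _ n, Nat.add_mul_div_right _ _ hd,
        Nat.div_eq_of_lt hm, Nat.div_eq_of_lt hn] using this
  have h1 : p.fst = q.fst := hquot hp hq (by rw [← L_ofBruckReilly, h, L_ofBruckReilly])
  have h2 : p.snd = q.snd := hquot hp hq (by rw [← R_ofBruckReilly, h, R_ofBruckReilly])
  refine BruckReilly.ext h1 (C.ofClifford_injective ?_) h2
  rw [← C.pow_mul_ofBruckReilly_mul ha, ← C.pow_mul_ofBruckReilly_mul ha, h, h1, h2]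

theorem ofBruckReilly_surjective (hmod : ∀ x, C.L x ≡ C.R x [MOD C.R a]) :
    Function.Surjective (C.ofBruckReilly ha) := by
  intro x
  have hd : 0 < C.R a := NeZero.pos _
  have hL := Nat.div_add_mod' (C.L x) (C.R a)
  have hR := Nat.div_add_mod' (C.R x) (C.R a)
  have hlt := Nat.mod_lt (C.R x) hd
  have hm : C.L x % C.R a = C.R x % C.R a := hmod x
  set i := C.L x / C.R a
  set j := C.R x / C.R a
  have h1 : C.L (a ^ i * x * C.inv a ^ j) = C.R x % C.R a := by
    simp only [← inv_pow, L_mul, R_mul, L_inv, C.L_R_pow ha]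
    omega
  have h2 : C.R (a ^ i * x * C.inv a ^ j) = C.R x % C.R a := by
    simp only [← inv_pow, R_mul, L_inv, R_inv, C.L_R_pow ha]
    omega
  obtain ⟨t, ht⟩ := C.exists_ofClifford_eq (h1.trans h2.symm) (h2.trans_lt hlt)
  refine ⟨⟨i, t, j⟩, ?_⟩
  change C.inv a ^ i * C.ofClifford t * a ^ j = x
  rw [ht, C.inv_pow_mul_pow_mul ha (by omega) (by omega)]

section Topology

variable [TopologicalSpace S]

instance (d : ℕ) (α : Level.{u} d) : TopologicalSpace ((C.clifford d).G α) :=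
  inferInstanceAs (TopologicalSpace (C.hClass α.val α.val))

theorem continuous_ofClifford (d : ℕ) : Continuous (C.ofClifford (d := d)) :=
  continuous_sigma fun _ => continuous_subtype_val

variable [SeparatelyContinuousMul S] [T2Space S]

theorem isOpenEmbedding_ofClifford (hc : ∀ n, IsCompact (C.hClass n n)) (d : ℕ) :
    Topology.IsOpenEmbedding (C.ofClifford (d := d)) := by
  refine .of_continuous_injective_isOpenMap (C.continuous_ofClifford d) C.ofClifford_injective ?_
  exact isOpenMap_sigma.2 fun α => (C.isOpen_hClass hc α.val α.val).isOpenMap_subtype_val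

/-- The bijection from the Bruck-Reilly extension onto `S` is a homeomorphism for the sum direct
topology, since the `H`-classes are open. -/
theorem isHomeomorph_ofBruckReilly (hc : ∀ n, IsCompact (C.hClass n n))
    (hmod : ∀ x, C.L x ≡ C.R x [MOD C.R a]) :
    @IsHomeomorph _ _ (BruckReilly.sumDirectTopology (C.theta ha)) _ (C.ofBruckReilly ha) := by
  let _ := BruckReilly.sumDirectTopology (C.theta ha)
  refine ⟨?_, ?_, C.ofBruckReilly_injective ha, C.ofBruckReilly_surjective ha hmod⟩
  · refine continuous_def.2 fun W hW => (BruckReilly.isOpen_sumDirectTopology_iff _).2 fun i j => ?_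
    exact hW.preimage (((C.continuous_ofClifford _).const_mul (C.inv a ^ i)).mul_const (a ^ j))
  · intro W hW
    refine isOpen_iff_mem_nhds.2 ?_
    rintro _ ⟨p, hp, rfl⟩
    have hV := (C.isOpenEmbedding_ofClifford hc _).isOpenMap _
      ((BruckReilly.isOpen_sumDirectTopology_iff _).1 hW p.fst p.snd)
    have hV' := hV.preimage ((continuous_const_mul (a ^ p.fst)).mul_const (C.inv a ^ p.snd))
    refine Filter.mem_of_superset (Filter.inter_mem (hV'.mem_nhds
      ⟨p.mid, hp, (C.pow_mul_ofBruckReilly_mul ha p).symm⟩)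
      ((C.isOpen_hClass hc _ _).mem_nhds ⟨rfl, rfl⟩)) ?_
    rintro x ⟨⟨t, ht, hxt⟩, hL, hR⟩
    refine ⟨_, ht, ?_⟩
    rw [L_ofBruckReilly] at hL
    rw [R_ofBruckReilly] at hR
    rw [← C.inv_pow_mul_pow_mul ha (x := x) (i := p.fst) (j := p.snd) (by omega) (by omega)]
    change C.inv a ^ p.fst * C.ofClifford t * a ^ p.snd = _
    rw [hxt]

end Topology

end InverseOmegaMonoid

end OmegaSemigroup

theorem theorem2p9 {S : Type u} [Semigroup S] [TopologicalSpace S] [T2Space S]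
    [SeparatelyContinuousMul S]
    (hinv : OmegaSemigroup.IsInverseSemigroup S)
    (hsimple : OmegaSemigroup.IsSimpleSemigroup S)
    (homega : OmegaSemigroup.IsOmegaSemigroup S)
    (hcompact : ∀ e : S, IsIdempotentElem e → IsCompact (OmegaSemigroup.maximalSubgroup e)) :
    (∃ (E : Type u) (_ : SemilatticeInf E) (_ : OrderTop E) (_ : Finite E)
      (T : OmegaSemigroup.SemilatticeOfGroups.{u, u} E)
      (_ : ∀ α, TopologicalSpace (T.G α))
      (θ : T.Carrier →* T.Carrierˣ)
      (τ : TopologicalSpace (OmegaSemigroup.BruckReilly T.Carrier θ)),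
      (∀ α, CompactSpace (T.G α) ∧ T2Space (T.G α) ∧ IsTopologicalGroup (T.G α)) ∧
      τ = OmegaSemigroup.BruckReilly.sumDirectTopology θ ∧
      OmegaSemigroup.BruckReilly.IsTopologicalExtension θ
        (fun N _ _ => OmegaSemigroup.IsTopologicalInverseSemigroup N) τ ∧
      Nonempty (S ≃ₜ* OmegaSemigroup.BruckReilly T.Carrier θ)) ∧
    LocallyCompactSpace S := by
  obtain ⟨M, rfl, ⟨C⟩⟩ := OmegaSemigroup.exists_inverseOmegaMonoid hinv homega
  have hc : ∀ n, IsCompact (C.hClass n n) := fun n => by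
    rw [← C.maximalSubgroup_e]
    exact hcompact _ (C.isIdempotentElem_e n)
  refine ⟨?_, C.locallyCompactSpace hc⟩
  obtain ⟨a, ha, hpos, hmod⟩ := C.exists_period hsimple
  have : NeZero (C.R a) := ⟨hpos.ne'⟩
  have hS := C.isTopologicalInverseSemigroup hc
  have hΦ := C.isHomeomorph_ofBruckReilly ha hc hmod
  let τ := OmegaSemigroup.BruckReilly.sumDirectTopology (C.theta ha)
  refine ⟨OmegaSemigroup.Level (C.R a), inferInstance, inferInstance, inferInstance,
    C.clifford (C.R a), inferInstance, C.theta ha, τ, fun α => ⟨?_, ?_, ?_⟩, rfl,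
    ⟨?_, ?_, 0, OmegaSemigroup.BruckReilly.isEmbedding_mk _ 0⟩, ⟨?_⟩⟩
  · exact isCompact_iff_compactSpace.1 (hc α.val)
  · exact inferInstanceAs (T2Space (C.hClass α.val α.val))
  · exact C.isTopologicalGroup_hClass hc α.val
  · refine hS.of_isEmbedding C.ofClifford (C.isOpenEmbedding_ofClifford hc _).isEmbedding
      C.ofClifford_mul fun t => C.exists_ofClifford_eq ?_ ?_
    · exact (C.L_inv _).trans ((C.L_ofClifford t).symm.trans (C.R_inv _).symm)
    · exact (C.R_inv _).trans_lt ((C.L_ofClifford t).trans_lt (C.R_ofClifford_lt t))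
  · exact hS.of_isEmbedding (C.ofBruckReilly ha) hΦ.isEmbedding (C.ofBruckReilly_mul ha)
      fun p => C.ofBruckReilly_surjective ha hmod _
  · exact
      { hΦ.homeomorph.symm with
        map_mul' := ((MulEquiv.mk' hΦ.homeomorph.toEquiv (C.ofBruckReilly_mul ha)).symm).map_mul }
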